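/- Let $X$ be a finite-dimensional real Hilbert space. For a family of sets $(C_i)$ in $X$ and indices $i\to *$: the outer limit $\limsup C_i$ is the set of $w$ for which there are a sequence $i_k\to *$ and $w_k\in C_{i_k}$ with $w_k\to w$; the inner limit $\liminf C_i$ is the set of $w$ such that for every sequence $i_k\to *$ there are $w_k\to w$ with $w_k\in C_{i_k}$ for all large $k$; and $C_i$ converges to $L$ if both limits equal $L$. Below, "$x\to\bar x$ in $S$" means $x\to\bar x$ with $x\in S$ ($x=\bar x$ is allowed if $\bar x\in S$), and $t\searrow 0$ means $t\to0$ with $t>0$. For $\Omega\subset X$ and $x\in\Omega$ let $$T_\Omega(x)=\limsup_{t\searrow0}\tfrac{\Omega-x}{t},\qquad \check T_\Omega(x)=\liminf_{t\searrow0}\tfrac{\Omega-x}{t},$$ $$\widehat T_\Omega(x)=\liminf_{x'\to x\text{ in }\Omega,\;t\searrow0}\tfrac{\Omega-x'}{t},\qquad \widetilde T_\Omega(x)=\limsup_{x'\to x\text{ in }\Omega,\;t\searrow0}\tfrac{\Omega-x'}{t}$$ be the tangent, derivable, regular (Clarke) and paratingent cones. The set $\Omega$ is called *derivable* at $x$ if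 $\check T_\Omega(x)=T_\Omega(x)$; *smooth* at $x$ if it is derivable at $x$ and $T_\Omega(x)$ is a linear subspace; and *strictly smooth* at $x$ if $\widehat T_\Omega(x)=\widetilde T_\Omega(x)$. It is *locally closed around* $x$ if $\Omega\cap V$ is closed for some closed neighbourhood $V$ of $x$. It is a *Lipschitzian manifold around* $x$ if there are an open neighbourhood $O$ of $x$, a splitting $X=Y\times Z$ into finite-dimensional spaces, and a $C^1$-diffeomorphism $\Phi$ from $O$ onto an open set $U=U'\times U''\subset Y\times Z$ such that $\Phi(\Omega\cap O)=(\operatorname{gph} f)\cap U$ for some Lipschitz continuous function $f:U'\to U''$. **Theorem.** Let $\Omega\subset X$ and $\bar x\in\Omega$, and let $\Omega$ be locally closed around $\bar x$. Consider the properties - (a) $\Omega$ is strictly smooth at $\bar x$; - (b) $T_\Omega(x)$ converges to $T_\Omega(\bar x)$ as $x\to\bar x$ in $\Omega$. Then (a) implies (b). If, in addition, $\Omega$ is a Lipschitzian manifold around $\bar x$, then (b) also implies (a), and both are equivalent to each of the following: - (c) $T_\Omega(x)$ converges to $T_\Omega(\bar x)$ as $x\to\bar x$ in the set of points $x\in\Omega$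 at which $\Omega$ is derivable; - (d) $T_\Omega(x)$ converges to $T_\Omega(\bar x)$ as $x\to\bar x$ in the set of points $x\in\Omega$ at which $\Omega$ is smooth; - (e) $T_\Omega(x)$ converges (to some set) as $x\to\bar x$ in the set of points $x\in\Omega$ at which $\Omega$ is smooth. -/

import Mathlib

open Filter Topology Set
open scoped NNReal

namespace VarGeom

/-- Inner limit (Painlevé–Kuratowski `liminf`) of a family of sets `C i` along a filter `l` on the
index set: the `w` such that for every sequence of indices `i k → l` there are `v k → w` with
`v k ∈ C (i k)` for all large `k`. -/
def innerLimit {ι X : Type*} [TopologicalSpace X] (l : Filter ι) (C : ι → Set X) : Set X :=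
  {w | ∀ i : ℕ → ι, Tendsto i atTop l →
    ∃ v : ℕ → X, Tendsto v atTop (𝓝 w) ∧ ∀ᶠ k in atTop, v k ∈ C (i k)}

/-- Outer limit (Painlevé–Kuratowski `limsup`) of a family of sets `C i` along a filter `l`: the
`w` for which there are a sequence of indices `i k → l` and `v k → w` with `v k ∈ C (i k)`. -/
def outerLimit {ι X : Type*} [TopologicalSpace X] (l : Filter ι) (C : ι → Set X) : Set X :=
  {w | ∃ i : ℕ → ι, Tendsto i atTop l ∧
    ∃ v : ℕ → X, Tendsto v atTop (𝓝 w) ∧ ∀ k, v k ∈ C (i k)}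

/-- Set convergence `C i → L` along `l`: inner and outer limits both equal `L`. -/
def SetTendsto {ι X : Type*} [TopologicalSpace X] (l : Filter ι) (C : ι → Set X) (L : Set X) :
    Prop :=
  innerLimit l C = L ∧ outerLimit l C = L

section Cones

variable {X : Type*} [NormedAddCommGroup X] [NormedSpace ℝ X]

/-- The set `(Ω - x) / t` of difference quotients. -/
def quotientSet (Ω : Set X) (x : X) (t : ℝ) : Set X :=
  (fun y => t⁻¹ • (y - x)) '' Ω

theorem mem_quotientSet {Ω : Set X} {x w : X} {t : ℝ} (ht : 0 < t) :
    w ∈ quotientSet Ω x t ↔ x + t • w ∈ Ω := by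
  constructor
  · rintro ⟨y, hy, rfl⟩
    simpa [smul_smul, mul_inv_cancel₀ ht.ne'] using hy
  · intro h
    exact ⟨_, h, by simp [smul_smul, inv_mul_cancel₀ ht.ne']⟩

/-- The (Bouligand) tangent cone. -/
def tangentCone (Ω : Set X) (x : X) : Set X :=
  outerLimit (𝓝[>] (0 : ℝ)) (fun t => quotientSet Ω x t)

/-- The derivable (adjacent) cone. -/
def derivableCone (Ω : Set X) (x : X) : Set X :=
  innerLimit (𝓝[>] (0 : ℝ)) (fun t => quotientSet Ω x t)

/-- The regular (Clarke) tangent cone: the inner limit of `(Ω - x') / t` as `x' → x` within `Ω`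
and `t ↘ 0`. -/
def clarkeCone (Ω : Set X) (x : X) : Set X :=
  innerLimit (𝓝[Ω] x ×ˢ 𝓝[>] (0 : ℝ)) (fun p => quotientSet Ω p.1 p.2)

/-- The paratingent cone: the outer limit of `(Ω - x') / t` as `x' → x` within `Ω` and
`t ↘ 0`. -/
def paratingentCone (Ω : Set X) (x : X) : Set X :=
  outerLimit (𝓝[Ω] x ×ˢ 𝓝[>] (0 : ℝ)) (fun p => quotientSet Ω p.1 p.2)

/-- The derivable cone and the tangent cone agree at `x`. -/
def DerivableAt (Ω : Set X) (x : X) : Prop :=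
  derivableCone Ω x = tangentCone Ω x

/-- `Ω` is smooth at `x`: it is derivable there and its tangent cone is a linear subspace. -/
def SmoothSetAt (Ω : Set X) (x : X) : Prop :=
  derivableCone Ω x = tangentCone Ω x ∧ ∃ V : Submodule ℝ X, tangentCone Ω x = (V : Set X)

/-- `Ω` is strictly smooth at `x`. -/
def StrictlySmoothSetAt (Ω : Set X) (x : X) : Prop :=
  clarkeCone Ω x = paratingentCone Ω x

/-- `Ω` is locally closed around `x`: its intersection with some closed neighbourhood of `x` is
closed. -/
def LocallyClosedAround (Ω : Set X) (x : X) : Prop :=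
  ∃ V ∈ 𝓝 x, IsClosed V ∧ IsClosed (Ω ∩ V)

/-- `Ω` is a Lipschitzian manifold around `x`: for some splitting of `X` as the product of two
complementary linear subspaces `Y` and `Z` there is a `C¹` diffeomorphism `Φ` from an open
neighbourhood of `x` (its source) onto an open box `U' ×ˢ U''` of `Y × Z` (its target), taking the
part of `Ω` in the source to the graph of a Lipschitz continuous function `f : U' → U''`. -/
def LipschitzManifoldAround (Ω : Set X) (x : X) : Prop :=
  ∃ Y Z : Submodule ℝ X, IsCompl Y Z ∧
    ∃ (Φ : OpenPartialHomeomorph X (Y × Z)) (U' : Set Y) (U'' : Set Z) (f : Y → Z) (K : ℝ≥0),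
      x ∈ Φ.source ∧
      ContDiffOn ℝ 1 Φ Φ.source ∧ ContDiffOn ℝ 1 Φ.symm Φ.target ∧
      IsOpen U' ∧ IsOpen U'' ∧ Φ.target = U' ×ˢ U'' ∧
      MapsTo f U' U'' ∧ LipschitzOnWith K f U' ∧
      Φ '' (Ω ∩ Φ.source) = {p : Y × Z | p.1 ∈ U' ∧ p.2 = f p.1}

end Cones

end VarGeom

/-!
The cones of `Ω` are limits of the difference quotients `(Ω - y) / t`. The implication (a) ⇒ (b)
holds since an iterated outer limit of these quotients lies in the paratingent cone, and, closed
balls being compact, their joint inner limit, the Clarke cone, lies in the inner limit of the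
tangent cones.

On a Lipschitzian manifold a `C¹` chart `Φ` transports difference quotients, so that `Ω` may be
replaced by the graph of a Lipschitz function `f`. Where `f` is differentiable, `Ω` is smooth and
its tangent space is the preimage under `DΦ` of the graph of `Df`; where `f` is strictly
differentiable, `Ω` is strictly smooth. By Rademacher's theorem smooth points are dense. If the
tangent spaces at smooth points converge, then all limits of `Df` at the base point have the same
graph, hence they agree, and a mean value inequality, obtained by integrating along almost all
lines, shows that `f` is strictly differentiable.
-/

namespace VarGeom

section SetLimits

variable {ι κ X : Type*} [TopologicalSpace X] {l : Filter ι} {C C' : ι → Set X} {L L' : Set X}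
  {w : X}

theorem mem_innerLimit_of_tendsto {v : ι → X} (hv : Tendsto v l (𝓝 w))
    (h : ∀ᶠ i in l, v i ∈ C i) : w ∈ innerLimit l C :=
  fun i hi => ⟨v ∘ i, hv.comp hi, hi.eventually h⟩

theorem mem_outerLimit_of_eventually {i : ℕ → ι} {v : ℕ → X} (hi : Tendsto i atTop l)
    (hv : Tendsto v atTop (𝓝 w)) (h : ∀ᶠ k in atTop, v k ∈ C (i k)) : w ∈ outerLimit l C := by
  obtain ⟨N, hN⟩ := eventually_atTop.1 h
  exact ⟨fun k => i (k + N), hi.comp (tendsto_add_atTop_nat N), fun k => v (k + N),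
    hv.comp (tendsto_add_atTop_nat N), fun k => hN _ (Nat.le_add_left N k)⟩

theorem innerLimit_subset_outerLimit [l.NeBot] [l.IsCountablyGenerated] :
    innerLimit l C ⊆ outerLimit l C := by
  intro w hw
  obtain ⟨i, hi⟩ := exists_seq_tendsto l
  obtain ⟨v, hv, hvC⟩ := hw i hi
  exact mem_outerLimit_of_eventually hi hv hvC

theorem innerLimit_subset_innerLimit_comp {m : Filter κ} {φ : κ → ι} (hφ : Tendsto φ m l) :
    innerLimit l C ⊆ innerLimit m (C ∘ φ) :=
  fun _ hw i hi => hw (φ ∘ i) (hφ.comp hi)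

theorem outerLimit_comp_subset_outerLimit {m : Filter κ} {φ : κ → ι} (hφ : Tendsto φ m l) :
    outerLimit m (C ∘ φ) ⊆ outerLimit l C :=
  fun _ ⟨i, hi, hv⟩ => ⟨φ ∘ i, hφ.comp hi, hv⟩

theorem innerLimit_subset_of_eventuallyEq (h : C =ᶠ[l] C') : innerLimit l C ⊆ innerLimit l C' := by
  intro w hw i hi
  obtain ⟨v, hv, hvC⟩ := hw i hi
  refine ⟨v, hv, ?_⟩
  filter_upwards [hvC, hi.eventually h] with k hk hCC'
  rwa [← hCC']

theorem outerLimit_subset_of_eventuallyEq (h : C =ᶠ[l] C') : outerLimit l C ⊆ outerLimit l C' := by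
  rintro w ⟨i, hi, v, hv, hvC⟩
  exact mem_outerLimit_of_eventually hi hv ((hi.eventually h).mono fun k hk => hk ▸ hvC k)

namespace SetTendsto

theorem of_subset [l.NeBot] [l.IsCountablyGenerated] (hinner : L ⊆ innerLimit l C)
    (houter : outerLimit l C ⊆ L) : SetTendsto l C L :=
  ⟨(innerLimit_subset_outerLimit.trans houter).antisymm hinner,
    houter.antisymm (hinner.trans innerLimit_subset_outerLimit)⟩

theorem unique (h : SetTendsto l C L) (h' : SetTendsto l C L') : L = L' :=
  h.1.symm.trans h'.1

theorem comp {m : Filter κ} [m.NeBot] [m.IsCountablyGenerated] {φ : κ → ι}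
    (h : SetTendsto l C L) (hφ : Tendsto φ m l) : SetTendsto m (C ∘ φ) L :=
  of_subset (h.1.symm.subset.trans (innerLimit_subset_innerLimit_comp hφ))
    ((outerLimit_comp_subset_outerLimit hφ).trans h.2.subset)

theorem mono {l' : Filter ι} [l.NeBot] [l.IsCountablyGenerated] (h : SetTendsto l' C L)
    (hl : l ≤ l') : SetTendsto l C L :=
  h.comp (tendsto_id'.2 hl)

theorem congr (h : SetTendsto l C L) (hC : C =ᶠ[l] C') : SetTendsto l C' L :=
  ⟨h.1 ▸ (innerLimit_subset_of_eventuallyEq hC.symm).antisymm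
      (innerLimit_subset_of_eventuallyEq hC),
    h.2 ▸ (outerLimit_subset_of_eventuallyEq hC.symm).antisymm
      (outerLimit_subset_of_eventuallyEq hC)⟩

end SetTendsto

variable [FirstCountableTopology X]

theorem exists_seq_tendsto_of_forall_isOpen {D : ℕ → Set X}
    (h : ∀ V, IsOpen V → w ∈ V → ∀ᶠ k in atTop, (D k ∩ V).Nonempty) :
    ∃ v : ℕ → X, Tendsto v atTop (𝓝 w) ∧ ∀ᶠ k in atTop, v k ∈ D k := by
  classical
  obtain ⟨V, hV, hbasis⟩ := (nhds_basis_opens w).exists_antitone_subbasis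
  -- In `D k` choose a point of `V n` with `n ≤ k` as large as possible.
  let n : ℕ → ℕ := fun k => Nat.findGreatest (fun n => (D k ∩ V n).Nonempty) k
  have hn : Tendsto n atTop atTop := tendsto_atTop.2 fun m => by
    filter_upwards [h (V m) (hV m).2 (hV m).1, eventually_ge_atTop m] with k hk hmk
    exact Nat.le_findGreatest hmk hk
  have hmem : ∀ᶠ k in atTop, (D k ∩ V (n k)).Nonempty := by
    filter_upwards [h (V 0) (hV 0).2 (hV 0).1] with k hk
    exact Nat.findGreatest_spec (P := fun n => (D k ∩ V n).Nonempty) (Nat.zero_le k) hk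
  have : ∀ k, ∃ v, (D k ∩ V (n k)).Nonempty → v ∈ D k ∩ V (n k) := fun k => by
    by_cases hk : (D k ∩ V (n k)).Nonempty
    · exact hk.imp fun v hv _ => hv
    · exact ⟨w, fun hk' => absurd hk' hk⟩
  choose v hv using this
  refine ⟨v, hbasis.tendsto_right_iff.2 fun m _ => ?_, hmem.mono fun k hk => (hv k hk).1⟩
  filter_upwards [hmem, hn.eventually_ge_atTop m] with k hk hmn
  exact hbasis.antitone hmn (hv k hk).2

variable [l.IsCountablyGenerated]

theorem mem_innerLimit_iff :
    w ∈ innerLimit l C ↔ ∀ V, IsOpen V → w ∈ V → ∀ᶠ i in l, (C i ∩ V).Nonempty := by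
  refine ⟨fun hw V hV hwV => ?_, fun h i hi =>
    exists_seq_tendsto_of_forall_isOpen fun V hV hwV => hi.eventually (h V hV hwV)⟩
  by_contra hcon
  obtain ⟨i, hi, hiC⟩ := exists_seq_forall_of_frequently (not_eventually.1 hcon)
  obtain ⟨v, hv, hvC⟩ := hw i hi
  obtain ⟨k, hkV, hkC⟩ := ((hv.eventually (hV.mem_nhds hwV)).and hvC).exists
  exact hiC k ⟨v k, hkC, hkV⟩

theorem mem_outerLimit_iff :
    w ∈ outerLimit l C ↔ ∀ V, IsOpen V → w ∈ V → ∃ᶠ i in l, (C i ∩ V).Nonempty := by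
  constructor
  · rintro ⟨i, hi, v, hv, hvC⟩ V hV hwV
    have hvV := hv.eventually (hV.mem_nhds hwV)
    exact hi.frequently (hvV.mono fun k hk => ⟨v k, hvC k, hk⟩).frequently
  · intro h
    obtain ⟨B, hB⟩ := l.exists_antitone_basis
    obtain ⟨V, hV, hbasis⟩ := (nhds_basis_opens w).exists_antitone_subbasis
    have hex : ∀ k, ∃ i ∈ B k, (C i ∩ V k).Nonempty := fun k =>
      (((h (V k) (hV k).2 (hV k).1).and_eventually (hB.mem k)).exists).imp fun _ hi => hi.symm
    choose i hiB v hv using hex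
    exact ⟨i, hB.tendsto hiB, v, hbasis.tendsto fun k => (hv k).2, fun k => (hv k).1⟩

theorem isClosed_outerLimit : IsClosed (outerLimit l C) := by
  refine isClosed_of_closure_subset fun w hw => mem_outerLimit_iff.2 fun V hV hwV => ?_
  obtain ⟨v, hvV, hv⟩ := mem_closure_iff.1 hw V hV hwV
  exact mem_outerLimit_iff.1 hv V hV hvV

theorem innerLimit_subset_closure {i : ι} (hi : pure i ≤ l) : innerLimit l C ⊆ closure (C i) := by
  intro w hw
  refine mem_closure_iff.2 fun V hV hwV => ?_
  rw [inter_comm]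
  exact hi (mem_innerLimit_iff.1 hw V hV hwV)

theorem outerLimit_inter_nonempty_of_isCompact {S : Set X} (hS : IsCompact S)
    (h : ∃ᶠ i in l, (C i ∩ S).Nonempty) : (outerLimit l C ∩ S).Nonempty := by
  obtain ⟨i, hi, hiC⟩ := exists_seq_forall_of_frequently h
  choose v hvC hvS using hiC
  obtain ⟨a, ha, φ, hφ, hlim⟩ := hS.tendsto_subseq hvS
  exact ⟨a, ⟨i ∘ φ, hi.comp hφ.tendsto_atTop, v ∘ φ, hlim, fun k => hvC _⟩, ha⟩

variable {m : Filter κ} [m.IsCountablyGenerated] {Q : ι → κ → Set X}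

theorem outerLimit_outerLimit_subset :
    outerLimit l (fun i => outerLimit m (Q i)) ⊆ outerLimit (l ×ˢ m) (fun p => Q p.1 p.2) := by
  intro w hw
  refine mem_outerLimit_iff.2 fun V hV hwV hcon => ?_
  refine mem_outerLimit_iff.1 hw V hV hwV (hcon.curry.mono ?_)
  rintro i hi ⟨v, hv, hvV⟩
  exact mem_outerLimit_iff.1 hv V hV hvV hi

theorem innerLimit_prod_subset_innerLimit_outerLimit [LocallyCompactSpace X] [m.NeBot] :
    innerLimit (l ×ˢ m) (fun p => Q p.1 p.2) ⊆ innerLimit l (fun i => outerLimit m (Q i)) := by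
  intro w hw
  refine mem_innerLimit_iff.2 fun V hV hwV => ?_
  obtain ⟨S, hS, hwS, hSV⟩ := exists_compact_subset hV hwV
  filter_upwards [(mem_innerLimit_iff.1 hw _ isOpen_interior hwS).curry] with i hi
  have hmeets : ∃ᶠ j in m, (Q i j ∩ S).Nonempty :=
    (hi.mono fun j hj => hj.mono (inter_subset_inter_right _ interior_subset)).frequently
  exact (outerLimit_inter_nonempty_of_isCompact hS hmeets).mono (inter_subset_inter_right _ hSV)

end SetLimits

section Cones

variable {X : Type*} [NormedAddCommGroup X] [NormedSpace ℝ X] {Ω : Set X} {x : X}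

theorem tangentCone_subset_paratingentCone (hx : x ∈ Ω) :
    tangentCone Ω x ⊆ paratingentCone Ω x :=
  outerLimit_comp_subset_outerLimit (C := fun p : X × ℝ => quotientSet Ω p.1 p.2)
    ((tendsto_const_pure.mono_right (pure_le_nhdsWithin hx)).prodMk tendsto_id)

theorem outerLimit_tangentCone_subset_paratingentCone :
    outerLimit (𝓝[Ω] x) (tangentCone Ω) ⊆ paratingentCone Ω x :=
  outerLimit_outerLimit_subset

theorem clarkeCone_subset_innerLimit_tangentCone [LocallyCompactSpace X] :
    clarkeCone Ω x ⊆ innerLimit (𝓝[Ω] x) (tangentCone Ω) :=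
  innerLimit_prod_subset_innerLimit_outerLimit

theorem innerLimit_tangentCone_subset_tangentCone (hx : x ∈ Ω) :
    innerLimit (𝓝[Ω] x) (tangentCone Ω) ⊆ tangentCone Ω x :=
  (innerLimit_subset_closure (pure_le_nhdsWithin hx)).trans isClosed_outerLimit.closure_subset

theorem StrictlySmoothSetAt.setTendsto_tangentCone [LocallyCompactSpace X] (hx : x ∈ Ω)
    (h : StrictlySmoothSetAt Ω x) : SetTendsto (𝓝[Ω] x) (tangentCone Ω) (tangentCone Ω x) := by
  have := nhdsWithin_neBot_of_mem hx
  have hpara : paratingentCone Ω x ⊆ innerLimit (𝓝[Ω] x) (tangentCone Ω) :=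
    (Eq.symm h).subset.trans clarkeCone_subset_innerLimit_tangentCone
  exact .of_subset ((tangentCone_subset_paratingentCone hx).trans hpara)
    ((outerLimit_tangentCone_subset_paratingentCone.trans hpara).trans
      (innerLimit_tangentCone_subset_tangentCone hx))

end Cones

section LipschitzMaps

open MeasureTheory

theorem norm_sub_le_of_ae_norm_deriv_le {F : Type*} [NormedAddCommGroup F] [NormedSpace ℝ F]
    {φ : ℝ → F} {K : ℝ≥0} {a b C : ℝ} (hab : a ≤ b) (hφ : LipschitzOnWith K φ (Icc a b))
    (h : ∀ᵐ t : ℝ, t ∈ Icc a b → DifferentiableAt ℝ φ t ∧ ‖deriv φ t‖ ≤ C) :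
    ‖φ b - φ a‖ ≤ C * (b - a) := by
  obtain ⟨ℓ, hℓ, hℓφ⟩ := exists_dual_vector'' ℝ (φ b - φ a)
  have hlip : LipschitzOnWith (‖ℓ‖₊ * K) (ℓ ∘ φ) (uIcc a b) := by
    rw [uIcc_of_le hab]
    exact ℓ.lipschitz.comp_lipschitzOnWith hφ
  have hbound : ‖∫ t in a..b, deriv (ℓ ∘ φ) t‖ ≤ C * |b - a| := by
    refine intervalIntegral.norm_integral_le_of_norm_le_const_ae ?_
    filter_upwards [h] with t ht htm
    rw [uIoc_of_le hab] at htm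
    obtain ⟨hd, hdC⟩ := ht ⟨htm.1.le, htm.2⟩
    rw [(ℓ.hasFDerivAt.comp_hasDerivAt t hd.hasDerivAt).deriv]
    calc ‖ℓ (deriv φ t)‖ ≤ 1 * ‖deriv φ t‖ := ℓ.le_of_opNorm_le hℓ _
      _ ≤ C := by rwa [one_mul]
  have hftc : ∫ t in a..b, deriv (ℓ ∘ φ) t = ‖φ b - φ a‖ := by
    rw [hlip.absolutelyContinuousOnInterval.integral_deriv_eq_sub, Function.comp_apply,
      Function.comp_apply, ← map_sub, hℓφ]
    rfl
  rwa [hftc, norm_norm, abs_of_nonneg (sub_nonneg.2 hab)] at hbound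

section NormedSpace

variable {E F : Type*} [NormedAddCommGroup E] [NormedSpace ℝ E] [NormedAddCommGroup F]
  [NormedSpace ℝ F] {f : E → F} {K : ℝ≥0} {U : Set E}

theorem norm_sub_le_of_ae_differentiableAt_segment {p v : E} {C : ℝ} (hf : LipschitzOnWith K f U)
    (hseg : ∀ t ∈ Icc (0 : ℝ) 1, p + t • v ∈ U)
    (hd : ∀ᵐ t : ℝ, p + t • v ∈ U → DifferentiableAt ℝ f (p + t • v))
    (hC : ∀ u ∈ U, DifferentiableAt ℝ f u → ‖fderiv ℝ f u‖ ≤ C) :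
    ‖f (p + v) - f p‖ ≤ C * ‖v‖ := by
  have hline : LipschitzWith ‖v‖₊ fun t : ℝ => p + t • v :=
    LipschitzWith.of_dist_le_mul fun s t => by
      rw [dist_add_left, dist_eq_norm, ← sub_smul, norm_smul, mul_comm, coe_nnnorm, dist_eq_norm]
  have hφ : LipschitzOnWith (K * ‖v‖₊) (fun t : ℝ => f (p + t • v)) (Icc 0 1) :=
    hf.comp hline.lipschitzOnWith hseg
  have hderiv : ∀ᵐ t : ℝ, t ∈ Icc (0 : ℝ) 1 →
      DifferentiableAt ℝ (fun t : ℝ => f (p + t • v)) t ∧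
        ‖deriv (fun t : ℝ => f (p + t • v)) t‖ ≤ C * ‖v‖ := by
    filter_upwards [hd] with t ht htI
    have htU := hseg t htI
    have hcurve : HasDerivAt (fun t : ℝ => p + t • v) v t := by
      simpa using ((hasDerivAt_id t).smul_const v).const_add p
    have hcomp : HasDerivAt (fun t : ℝ => f (p + t • v)) (fderiv ℝ f (p + t • v) v) t :=
      (ht htU).hasFDerivAt.comp_hasDerivAt t hcurve
    refine ⟨hcomp.differentiableAt, ?_⟩
    rw [hcomp.deriv]
    exact ContinuousLinearMap.le_of_opNorm_le _ (hC _ htU (ht htU)) v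
  simpa using norm_sub_le_of_ae_norm_deriv_le zero_le_one hφ hderiv

end NormedSpace

variable {E F : Type*} [NormedAddCommGroup E] [NormedSpace ℝ E] [FiniteDimensional ℝ E]
  [NormedAddCommGroup F] [NormedSpace ℝ F] [FiniteDimensional ℝ F] {f : E → F} {K : ℝ≥0}
  {U : Set E}

theorem ae_differentiableAt_of_lipschitzOnWith [MeasurableSpace E] [BorelSpace E] (μ : Measure E)
    [μ.IsAddHaarMeasure] (hU : IsOpen U) (hf : LipschitzOnWith K f U) :
    ∀ᵐ u ∂μ, u ∈ U → DifferentiableAt ℝ f u := by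
  filter_upwards [hf.ae_differentiableWithinAt_of_mem (μ := μ)] with u hu huU
  exact (hu huU).differentiableAt (hU.mem_nhds huU)

theorem subset_closure_differentiableAt (hU : IsOpen U) (hf : LipschitzOnWith K f U) :
    U ⊆ closure {u | DifferentiableAt ℝ f u} := by
  borelize E
  have hdense := Measure.dense_of_ae (ae_differentiableAt_of_lipschitzOnWith Measure.addHaar hU hf)
  exact (hdense.open_subset_closure_inter hU).trans (closure_mono fun u hu => hu.2 hu.1)

theorem dense_ae_differentiableAt_line (hU : IsOpen U) (hf : LipschitzOnWith K f U) (v : E) :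
    Dense {p | ∀ᵐ t : ℝ, p + t • v ∈ U → DifferentiableAt ℝ f (p + t • v)} := by
  borelize E
  have hmeas : MeasurableSet {u | u ∈ U → DifferentiableAt ℝ f u} := by
    simp only [imp_iff_not_or]
    exact hU.measurableSet.compl.union (measurableSet_of_differentiableAt ℝ f)
  exact Measure.dense_of_ae ((ae_ae_add_linearMap_mem_iff (LinearMap.toSpanSingleton ℝ E v)
    volume Measure.addHaar hmeas).2 (ae_differentiableAt_of_lipschitzOnWith _ hU hf))

theorem norm_sub_le_of_norm_fderiv_le_of_lipschitzOnWith (hU : IsOpen U) (hconv : Convex ℝ U)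
    (hf : LipschitzOnWith K f U) {C : ℝ}
    (hC : ∀ u ∈ U, DifferentiableAt ℝ f u → ‖fderiv ℝ f u‖ ≤ C) {a b : E} (ha : a ∈ U)
    (hb : b ∈ U) : ‖f b - f a‖ ≤ C * ‖b - a‖ := by
  -- Move the segment `[a, b]` to a parallel one almost all of whose points are points of
  -- differentiability.
  set v := b - a
  set W : Set E := U ∩ (· + v) ⁻¹' U
  set D : Set E := {p | ∀ᵐ t : ℝ, p + t • v ∈ U → DifferentiableAt ℝ f (p + t • v)}
  have hshift : Continuous (· + v : E → E) := by fun_prop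
  have hab : a + v = b := add_sub_cancel a b
  have haW : a ∈ W := ⟨ha, by rwa [mem_preimage, hab]⟩
  have hne : (𝓝[W ∩ D] a).NeBot := mem_closure_iff_nhdsWithin_neBot.1
    ((dense_ae_differentiableAt_line hU hf v).open_subset_closure_inter
      (hU.inter (hU.preimage hshift)) haW)
  have hcont : ContinuousAt (fun p => ‖f (p + v) - f p‖) a :=
    ((ContinuousAt.comp (f := (· + v)) (hf.continuousOn.continuousAt (hU.mem_nhds haW.2))
      hshift.continuousAt).sub (hf.continuousOn.continuousAt (hU.mem_nhds ha))).norm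
  rw [← hab]
  refine le_of_tendsto (hcont.tendsto.mono_left (nhdsWithin_le_nhds (s := W ∩ D))) ?_
  filter_upwards [self_mem_nhdsWithin (s := W ∩ D)] with p ⟨⟨hpU, hpvU⟩, hpD⟩
  refine norm_sub_le_of_ae_differentiableAt_segment hf (fun t ht => ?_) hpD hC
  simpa using hconv.add_smul_sub_mem hpU hpvU ht

theorem hasStrictFDerivAt_of_tendsto_fderiv (hU : IsOpen U) (hf : LipschitzOnWith K f U) {a : E}
    (ha : a ∈ U) {A : E →L[ℝ] F}
    (h : Tendsto (fderiv ℝ f) (𝓝[{u | DifferentiableAt ℝ f u}] a) (𝓝 A)) :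
    HasStrictFDerivAt f A a := by
  refine .of_isLittleO (Asymptotics.isLittleO_iff.2 fun ε hε => ?_)
  have hnear := eventually_nhdsWithin_iff.1 (h.eventually (Metric.closedBall_mem_nhds A hε))
  obtain ⟨δ, hδ, hball⟩ := Metric.eventually_nhds_iff_ball.1 (hnear.and (hU.eventually_mem ha))
  have hlip : LipschitzOnWith (K + ‖A‖₊) (f - ⇑A) (Metric.ball a δ) :=
    (hf.mono fun u hu => (hball u hu).2).sub A.lipschitz.lipschitzOnWith
  have hderiv : ∀ u ∈ Metric.ball a δ, DifferentiableAt ℝ (f - ⇑A) u →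
      ‖fderiv ℝ (f - ⇑A) u‖ ≤ ε := fun u hu hd => by
    have hfd : DifferentiableAt ℝ f u := by simpa using hd.add A.differentiableAt
    rw [(hfd.hasFDerivAt.sub A.hasFDerivAt).fderiv, ← dist_eq_norm]
    exact (hball u hu).1 hfd
  rw [nhds_prod_eq]
  filter_upwards [prod_mem_prod (Metric.ball_mem_nhds a hδ) (Metric.ball_mem_nhds a hδ)]
    with p hp
  have hmean := norm_sub_le_of_norm_fderiv_le_of_lipschitzOnWith Metric.isOpen_ball
    (convex_ball a δ) hlip hderiv hp.2 hp.1
  rwa [Pi.sub_apply, Pi.sub_apply, sub_sub_sub_comm, ← map_sub] at hmean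

/-- The limiting Jacobian (Bouligand subdifferential) of `f` at `a`: the limits of derivatives of
`f` at points of differentiability tending to `a`. -/
def limitingJacobian {E F : Type*} [NormedAddCommGroup E] [NormedSpace ℝ E]
    [NormedAddCommGroup F] [NormedSpace ℝ F] (f : E → F) (a : E) : Set (E →L[ℝ] F) :=
  {A | MapClusterPt A (𝓝[{u | DifferentiableAt ℝ f u}] a) (fderiv ℝ f)}

theorem exists_hasStrictFDerivAt_of_limitingJacobian_subsingleton (hU : IsOpen U)
    (hf : LipschitzOnWith K f U) {a : E} (ha : a ∈ U) (h : (limitingJacobian f a).Subsingleton) :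
    ∃ A : E →L[ℝ] F, HasStrictFDerivAt f A a := by
  have : (𝓝[{u | DifferentiableAt ℝ f u}] a).NeBot :=
    mem_closure_iff_nhdsWithin_neBot.1 (subset_closure_differentiableAt hU hf ha)
  have hcomp : IsCompact (Metric.closedBall (0 : E →L[ℝ] F) K) :=
    isCompact_closedBall 0 _
  have hbounded : ∀ᶠ u in 𝓝[{u | DifferentiableAt ℝ f u}] a,
      fderiv ℝ f u ∈ Metric.closedBall 0 (K : ℝ) := by
    filter_upwards [nhdsWithin_le_nhds (hU.mem_nhds ha)] with u hu
    exact mem_closedBall_zero_iff.2 (norm_fderiv_le_of_lipschitzOn ℝ (hU.mem_nhds hu) hf)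
  obtain ⟨A, -, hA⟩ := hcomp.exists_mapClusterPt_of_frequently hbounded.frequently
  exact ⟨A, hasStrictFDerivAt_of_tendsto_fderiv hU hf ha
    (hcomp.tendsto_nhds_of_unique_mapClusterPt hbounded fun B _ hB => h hB hA)⟩

end LipschitzMaps

section DifferenceQuotients

variable {E F : Type*} [NormedAddCommGroup E] [NormedSpace ℝ E] [NormedAddCommGroup F]
  [NormedSpace ℝ F]

theorem tendsto_inv_smul_sub_of_hasFDerivAtFilter {ι : Type*} {l : Filter ι} {f : E → F}
    {f' : E →L[ℝ] F} {H : Filter E} {x w : E} {p v : ι → E} {t : ι → ℝ}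
    (hf : HasFDerivAtFilter f f' (𝓝 x ×ˢ H)) (hH : H ≤ 𝓝 x) (hp : Tendsto p l H)
    (ht : Tendsto t l (𝓝[>] (0 : ℝ))) (hv : Tendsto v l (𝓝 w)) :
    Tendsto (fun i => (t i)⁻¹ • (f (p i + t i • v i) - f (p i))) l (𝓝 (f' w)) := by
  have hpv : Tendsto (fun i => p i + t i • v i) l (𝓝 x) := by
    simpa using (hp.mono_right hH).add ((tendsto_nhds_of_tendsto_nhdsWithin ht).smul hv)
  have hquot : Tendsto (fun i => (t i)⁻¹ • (p i + t i • v i - p i)) l (𝓝 w) := by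
    refine hv.congr' ?_
    filter_upwards [ht.eventually self_mem_nhdsWithin] with i hi
    rw [add_sub_cancel_left, inv_smul_smul₀ (ne_of_gt hi)]
  have herror := (Asymptotics.isBigO_refl (fun i => (t i)⁻¹) l).smul_isLittleO
    (hf.isLittleO.comp_tendsto (hpv.prodMk hp))
  have hzero := (Asymptotics.isLittleO_one_iff ℝ).1 (herror.trans_isBigO (hquot.isBigO_one ℝ))
  rw [← zero_add (f' w)]
  refine (hzero.add ((f'.continuous.tendsto w).comp hquot)).congr fun i => ?_
  simp only [Function.comp_apply, smul_sub, map_sub, map_smul, sub_add_cancel]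

variable {Ω : Set E} {Θ : Set F} {g : E → F} {T : E →L[ℝ] F} {x w : E} {G : Filter E}

theorem exists_tendsto_mem_quotientSet_image {p v : ℕ → E} {t : ℕ → ℝ}
    (hg : HasStrictFDerivAt g T x) (hΘ : ∀ᶠ y in 𝓝[Ω] x, g y ∈ Θ) (hp : Tendsto p atTop (𝓝 x))
    (ht : Tendsto t atTop (𝓝[>] 0)) (hv : Tendsto v atTop (𝓝 w))
    (hvΩ : ∀ᶠ k in atTop, v k ∈ quotientSet Ω (p k) (t k)) :
    ∃ v' : ℕ → F, Tendsto v' atTop (𝓝 (T w)) ∧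
      ∀ᶠ k in atTop, v' k ∈ quotientSet Θ (g (p k)) (t k) := by
  have hg' : HasFDerivAtFilter g T (𝓝 x ×ˢ 𝓝 x) := nhds_prod_eq (x := x) (y := x) ▸ hg
  refine ⟨_, tendsto_inv_smul_sub_of_hasFDerivAtFilter hg' le_rfl hp ht hv, ?_⟩
  have hpv : Tendsto (fun k => p k + t k • v k) atTop (𝓝 x) := by
    simpa using hp.add ((tendsto_nhds_of_tendsto_nhdsWithin ht).smul hv)
  filter_upwards [hvΩ, ht.eventually self_mem_nhdsWithin,
    hpv.eventually (eventually_nhdsWithin_iff.1 hΘ)] with k hk htk hkΘ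
  exact mem_image_of_mem _ (hkΘ ((mem_quotientSet htk).1 hk))

theorem innerLimit_quotientSet_subset_preimage (hg : HasStrictFDerivAt g T x)
    (hΘ : ∀ᶠ y in 𝓝[Ω] x, g y ∈ Θ) (hG : G ≤ 𝓝 x) :
    innerLimit (G ×ˢ 𝓝[>] (0 : ℝ)) (fun p => quotientSet Ω p.1 p.2) ⊆
      T ⁻¹' innerLimit (G ×ˢ 𝓝[>] (0 : ℝ)) (fun p => quotientSet Θ (g p.1) p.2) := by
  intro w hw i hi
  obtain ⟨v, hv, hvΩ⟩ := hw i hi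
  exact exists_tendsto_mem_quotientSet_image hg hΘ ((tendsto_fst.comp hi).mono_right hG)
    (tendsto_snd.comp hi) hv hvΩ

theorem outerLimit_quotientSet_subset_preimage (hg : HasStrictFDerivAt g T x)
    (hΘ : ∀ᶠ y in 𝓝[Ω] x, g y ∈ Θ) (hG : G ≤ 𝓝 x) :
    outerLimit (G ×ˢ 𝓝[>] (0 : ℝ)) (fun p => quotientSet Ω p.1 p.2) ⊆
      T ⁻¹' outerLimit (map g G ×ˢ 𝓝[>] (0 : ℝ)) (fun p => quotientSet Θ p.1 p.2) := by
  rintro w ⟨i, hi, v, hv, hvΩ⟩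
  have hfst : Tendsto (fun k => (i k).1) atTop G := tendsto_fst.comp hi
  have hsnd : Tendsto (fun k => (i k).2) atTop (𝓝[>] 0) := tendsto_snd.comp hi
  obtain ⟨v', hv', hvΘ⟩ := exists_tendsto_mem_quotientSet_image hg hΘ (hfst.mono_right hG) hsnd hv
    (.of_forall hvΩ)
  exact mem_outerLimit_of_eventually
    (C := fun p : F × ℝ => quotientSet Θ p.1 p.2) (i := fun k => (g (i k).1, (i k).2))
    ((tendsto_map.comp hfst).prodMk hsnd) hv' hvΘ

/-- The difference quotients `(Ω - y) / t` converge to `L` as `y` tends to its limit along the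
filter `G` and `t ↘ 0`. Taking `G = pure x` gives the derivable and tangent cones, and `G = 𝓝[Ω] x`
the Clarke and paratingent cones. -/
def QuotientsTendsto (Ω : Set E) (G : Filter E) (L : Set E) : Prop :=
  SetTendsto (G ×ˢ 𝓝[>] (0 : ℝ)) (fun p => quotientSet Ω p.1 p.2) L

namespace QuotientsTendsto

theorem setTendsto {L : Set E} (h : QuotientsTendsto Ω (pure x) L) :
    SetTendsto (𝓝[>] (0 : ℝ)) (quotientSet Ω x) L :=
  h.comp (φ := fun t => (x, t)) (tendsto_const_pure.prodMk tendsto_id)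

theorem strictlySmoothSetAt {L : Set E} (h : QuotientsTendsto Ω (𝓝[Ω] x) L) :
    StrictlySmoothSetAt Ω x :=
  h.1.trans h.2.symm

theorem preimage [G.NeBot] [G.IsCountablyGenerated] {r : F → E} {S : F →L[ℝ] E} {L : Set F}
    (hL : QuotientsTendsto Θ (map g G) L) (hg : HasStrictFDerivAt g T x)
    (hr : HasStrictFDerivAt r S (g x)) (hrg : ∀ᶠ y in 𝓝 x, r (g y) = y)
    (hΘ : ∀ᶠ y in 𝓝[Ω] x, g y ∈ Θ) (hΩ : ∀ᶠ z in 𝓝[Θ] g x, r z ∈ Ω) (hG : G ≤ 𝓝 x) :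
    QuotientsTendsto Ω G (T ⁻¹' L) := by
  have hST : S.comp T = .id ℝ E := (hr.hasFDerivAt.comp x hg.hasFDerivAt).unique
    ((hasFDerivAt_id x).congr_of_eventuallyEq hrg)
  have hmap : map g G ≤ 𝓝 (g x) := hg.continuousAt.tendsto.mono_left hG
  refine .of_subset (fun w hw => ?_) fun w hw => ?_
  · have hTw : T w ∈ innerLimit (map g G ×ˢ 𝓝[>] (0 : ℝ)) (fun p => quotientSet Θ p.1 p.2) :=
      hL.1.symm.subset hw
    have hSTw := innerLimit_quotientSet_subset_preimage hr hΩ hmap hTw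
    rw [mem_preimage, ← ContinuousLinearMap.comp_apply, hST] at hSTw
    have hmapprod : Tendsto (Prod.map g id) (G ×ˢ 𝓝[>] (0 : ℝ)) (map g G ×ˢ 𝓝[>] (0 : ℝ)) :=
      tendsto_map.prodMap tendsto_id
    refine innerLimit_subset_of_eventuallyEq ?_ (innerLimit_subset_innerLimit_comp hmapprod hSTw)
    filter_upwards [tendsto_fst.eventually (hG hrg)] with p hp
    exact congrArg (quotientSet Ω · p.2) hp
  · exact hL.2.subset (outerLimit_quotientSet_subset_preimage hg hΘ hG hw)

theorem graphOn {f : E → F} {A : E →L[ℝ] F} {U : Set E} {u : E} {H : Filter E}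
    {G : Filter (E × F)} [G.NeBot] [G.IsCountablyGenerated]
    (hf : HasFDerivAtFilter f A (𝓝 u ×ˢ H)) (hU : U ∈ 𝓝 u) (hH : H ≤ 𝓝 u)
    (hG : ∀ᶠ y in G, y ∈ U.graphOn f) (hGH : Tendsto Prod.fst G H) :
    QuotientsTendsto (U.graphOn f) G A.graph := by
  refine .of_subset ?_ ?_
  · rintro ⟨a, b⟩ hab
    obtain rfl : b = A a := hab
    have hbase : Tendsto (fun p : (E × F) × ℝ => p.1.1) (G ×ˢ 𝓝[>] (0 : ℝ)) H :=
      hGH.comp tendsto_fst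
    have hmove : Tendsto (fun p : (E × F) × ℝ => p.1.1 + p.2 • a) (G ×ˢ 𝓝[>] (0 : ℝ)) (𝓝 u) := by
      simpa using (hbase.mono_right hH).add
        ((tendsto_nhds_of_tendsto_nhdsWithin tendsto_snd).smul_const a)
    refine mem_innerLimit_of_tendsto (tendsto_const_nhds.prodMk_nhds
      (tendsto_inv_smul_sub_of_hasFDerivAtFilter hf hH hbase tendsto_snd tendsto_const_nhds)) ?_
    filter_upwards [hmove hU, tendsto_fst.eventually hG, tendsto_snd.eventually self_mem_nhdsWithin]
      with p hpU hpG hpt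
    refine (mem_quotientSet hpt).2 (mem_graphOn.2 ⟨hpU, ?_⟩)
    simp [smul_inv_smul₀ (ne_of_gt hpt), ← (mem_graphOn.1 hpG).2]
  · rintro w ⟨i, hi, v, hv, hvΩ⟩
    have hfst : Tendsto (fun k => (i k).1) atTop G := tendsto_fst.comp hi
    have hsnd : Tendsto (fun k => (i k).2) atTop (𝓝[>] 0) := tendsto_snd.comp hi
    have hquot := tendsto_inv_smul_sub_of_hasFDerivAtFilter hf hH (hGH.comp hfst) hsnd hv.fst_nhds
    refine tendsto_nhds_unique hv.snd_nhds (hquot.congr' ?_)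
    filter_upwards [hfst.eventually hG, hsnd.eventually self_mem_nhdsWithin] with k hkG hkt
    have hmove := (mem_graphOn.1 ((mem_quotientSet hkt).1 (hvΩ k))).2
    simp only [Prod.fst_add, Prod.smul_fst, Prod.snd_add, Prod.smul_snd] at hmove
    simp [hmove, (mem_graphOn.1 hkG).2, inv_smul_smul₀ (ne_of_gt hkt)]

end QuotientsTendsto

end DifferenceQuotients

section Charts

variable {X E F : Type*} [NormedAddCommGroup X] [NormedSpace ℝ X] [NormedAddCommGroup E]
  [NormedSpace ℝ E] [NormedAddCommGroup F] [NormedSpace ℝ F]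

/-- The tangent space of a manifold that a chart with derivative `T` takes to the graph of a
function with derivative `A`: the preimage under `T` of the graph of `A`. -/
def chartTangentSpace (T : X →L[ℝ] E × F) (A : E →L[ℝ] F) : Submodule ℝ X :=
  A.graph.comap T.toLinearMap

theorem mem_chartTangentSpace {T : X →L[ℝ] E × F} {A : E →L[ℝ] F} {w : X} :
    w ∈ chartTangentSpace T A ↔ (T w).2 = A (T w).1 := Iff.rfl

theorem chartTangentSpace_injective {T : X →L[ℝ] E × F} (hT : Function.Surjective T) :
    Function.Injective (chartTangentSpace T) := by
  intro A B hAB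
  ext a
  obtain ⟨w, hw⟩ := hT (a, A a)
  have hwB : w ∈ chartTangentSpace T B := hAB ▸ mem_chartTangentSpace.2 (by rw [hw])
  simpa [hw] using mem_chartTangentSpace.1 hwB

theorem tendsto_clm_apply {ι : Type*} {l : Filter ι} {T : ι → E →L[ℝ] F} {T₀ : E →L[ℝ] F}
    {v : ι → E} {w : E} (hT : Tendsto T l (𝓝 T₀)) (hv : Tendsto v l (𝓝 w)) :
    Tendsto (fun i => T i (v i)) l (𝓝 (T₀ w)) :=
  (isBoundedBilinearMap_apply.continuous.tendsto (T₀, w)).comp (hT.prodMk_nhds hv)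

theorem setTendsto_chartTangentSpace {ι : Type*} {l : Filter ι} [l.NeBot] [l.IsCountablyGenerated]
    {T : ι → X →L[ℝ] E × F} {T₀ : X →L[ℝ] E × F} {S : ι → E × F →L[ℝ] X} {S₀ : E × F →L[ℝ] X}
    {A : ι → E →L[ℝ] F} {A₀ : E →L[ℝ] F} (hT : Tendsto T l (𝓝 T₀)) (hS : Tendsto S l (𝓝 S₀))
    (hA : Tendsto A l (𝓝 A₀)) (hTS : ∀ᶠ i in l, (T i).comp (S i) = .id ℝ (E × F))
    (hST₀ : S₀.comp T₀ = .id ℝ X) :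
    SetTendsto l (fun i => (chartTangentSpace (T i) (A i) : Set X)) (chartTangentSpace T₀ A₀) := by
  refine .of_subset (fun w hw => ?_) ?_
  · have hgraph : Tendsto (fun i => ((T₀ w).1, A i (T₀ w).1)) l (𝓝 (T₀ w)) := by
      have hconst : Tendsto (fun _ : ι => (T₀ w).1) l (𝓝 (T₀ w).1) := tendsto_const_nhds
      have h := hconst.prodMk_nhds (tendsto_clm_apply hA hconst)
      rwa [← mem_chartTangentSpace.1 hw] at h
    have hlim := tendsto_clm_apply hS hgraph
    rw [← ContinuousLinearMap.comp_apply, hST₀] at hlim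
    refine mem_innerLimit_of_tendsto hlim (hTS.mono fun i hi => mem_chartTangentSpace.2 ?_)
    rw [← ContinuousLinearMap.comp_apply, hi, ContinuousLinearMap.id_apply]
  · rintro w ⟨i, hi, v, hv, hvi⟩
    have hlim := tendsto_clm_apply (hT.comp hi) hv
    exact tendsto_nhds_unique (hlim.snd_nhds.congr fun k => mem_chartTangentSpace.1 (hvi k))
      (tendsto_clm_apply (hA.comp hi) hlim.fst_nhds)

/-- `Φ` is a `C¹` chart of `X` taking the part of `Ω` in its source to the graph over the open set
`U` of a function `f` that is `K`-Lipschitz there. -/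
structure IsLipschitzChart (Ω : Set X) (Φ : OpenPartialHomeomorph X (E × F)) (U : Set E)
    (f : E → F) (K : ℝ≥0) : Prop where
  contDiffOn : ContDiffOn ℝ 1 Φ Φ.source
  contDiffOn_symm : ContDiffOn ℝ 1 Φ.symm Φ.target
  isOpen : IsOpen U
  lipschitzOnWith : LipschitzOnWith K f U
  image_eq : Φ '' (Ω ∩ Φ.source) = U.graphOn f

namespace IsLipschitzChart

variable {Ω : Set X} {Φ : OpenPartialHomeomorph X (E × F)} {U : Set E} {f : E → F} {K : ℝ≥0}
  {x : X}

theorem apply_mem_graphOn (c : IsLipschitzChart Ω Φ U f K) (hx : x ∈ Ω) (hxs : x ∈ Φ.source) :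
    Φ x ∈ U.graphOn f :=
  c.image_eq ▸ mem_image_of_mem Φ ⟨hx, hxs⟩

theorem fst_apply_mem (c : IsLipschitzChart Ω Φ U f K) (hx : x ∈ Ω) (hxs : x ∈ Φ.source) :
    (Φ x).1 ∈ U :=
  (mem_graphOn.1 (c.apply_mem_graphOn hx hxs)).1

theorem mem_target (c : IsLipschitzChart Ω Φ U f K) {y : E × F} (hy : y ∈ U.graphOn f) :
    y ∈ Φ.target := by
  rw [← c.image_eq] at hy
  obtain ⟨z, ⟨-, hz⟩, rfl⟩ := hy
  exact Φ.map_source hz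

theorem symm_apply_mem (c : IsLipschitzChart Ω Φ U f K) {y : E × F} (hy : y ∈ U.graphOn f) :
    Φ.symm y ∈ Ω := by
  rw [← c.image_eq] at hy
  obtain ⟨z, ⟨hz, hzs⟩, rfl⟩ := hy
  rwa [Φ.left_inv hzs]

theorem hasStrictFDerivAt (c : IsLipschitzChart Ω Φ U f K) (hxs : x ∈ Φ.source) :
    HasStrictFDerivAt Φ (fderiv ℝ Φ x) x :=
  (c.contDiffOn.contDiffAt (Φ.open_source.mem_nhds hxs)).hasStrictFDerivAt one_ne_zero

theorem hasStrictFDerivAt_symm (c : IsLipschitzChart Ω Φ U f K) {y : E × F}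
    (hy : y ∈ Φ.target) : HasStrictFDerivAt Φ.symm (fderiv ℝ Φ.symm y) y :=
  (c.contDiffOn_symm.contDiffAt (Φ.open_target.mem_nhds hy)).hasStrictFDerivAt one_ne_zero

theorem fderiv_symm_comp_fderiv (c : IsLipschitzChart Ω Φ U f K) (hxs : x ∈ Φ.source) :
    (fderiv ℝ Φ.symm (Φ x)).comp (fderiv ℝ Φ x) = .id ℝ X :=
  ((c.hasStrictFDerivAt_symm (Φ.map_source hxs)).hasFDerivAt.comp x
    (c.hasStrictFDerivAt hxs).hasFDerivAt).unique
    ((hasFDerivAt_id x).congr_of_eventuallyEq (Φ.eventually_left_inverse hxs))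

theorem fderiv_comp_fderiv_symm (c : IsLipschitzChart Ω Φ U f K) {y : E × F} (hy : y ∈ Φ.target) :
    (fderiv ℝ Φ (Φ.symm y)).comp (fderiv ℝ Φ.symm y) = .id ℝ (E × F) :=
  ((c.hasStrictFDerivAt (Φ.map_target hy)).hasFDerivAt.comp y
    (c.hasStrictFDerivAt_symm hy).hasFDerivAt).unique
    ((hasFDerivAt_id y).congr_of_eventuallyEq (Φ.eventually_right_inverse hy))

theorem continuousAt_fderiv (c : IsLipschitzChart Ω Φ U f K) (hxs : x ∈ Φ.source) :
    ContinuousAt (fderiv ℝ Φ) x :=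
  (c.contDiffOn.continuousOn_fderiv_of_isOpen Φ.open_source le_rfl).continuousAt
    (Φ.open_source.mem_nhds hxs)

theorem continuousAt_fderiv_symm (c : IsLipschitzChart Ω Φ U f K) {y : E × F}
    (hy : y ∈ Φ.target) : ContinuousAt (fderiv ℝ Φ.symm) y :=
  (c.contDiffOn_symm.continuousOn_fderiv_of_isOpen Φ.open_target le_rfl).continuousAt
    (Φ.open_target.mem_nhds hy)

theorem quotientsTendsto (c : IsLipschitzChart Ω Φ U f K) (hx : x ∈ Ω) (hxs : x ∈ Φ.source)
    {A : E →L[ℝ] F} {G : Filter X} [G.NeBot] [G.IsCountablyGenerated] {H : Filter E}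
    (hf : HasFDerivAtFilter f A (𝓝 (Φ x).1 ×ˢ H)) (hH : H ≤ 𝓝 (Φ x).1) (hG : G ≤ 𝓝[Ω] x)
    (hGH : Tendsto (fun y => (Φ y).1) G H) :
    QuotientsTendsto Ω G (chartTangentSpace (fderiv ℝ Φ x) A) := by
  have himage : ∀ᶠ y in 𝓝[Ω] x, Φ y ∈ U.graphOn f := by
    filter_upwards [self_mem_nhdsWithin, nhdsWithin_le_nhds (Φ.open_source.mem_nhds hxs)]
      with y hy hys using c.apply_mem_graphOn hy hys
  have hpreimage : ∀ᶠ y in 𝓝[U.graphOn f] Φ x, Φ.symm y ∈ Ω :=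
    eventually_nhdsWithin_of_forall fun y => c.symm_apply_mem
  have hgraph : QuotientsTendsto (U.graphOn f) (map Φ G) A.graph :=
    .graphOn hf (c.isOpen.mem_nhds (c.fst_apply_mem hx hxs)) hH (hG himage) hGH
  exact hgraph.preimage (c.hasStrictFDerivAt hxs) (c.hasStrictFDerivAt_symm (Φ.map_source hxs))
    (Φ.eventually_left_inverse hxs) himage hpreimage (hG.trans nhdsWithin_le_nhds)

theorem strictlySmoothSetAt (c : IsLipschitzChart Ω Φ U f K) (hx : x ∈ Ω) (hxs : x ∈ Φ.source)
    {A : E →L[ℝ] F} (hf : HasStrictFDerivAt f A (Φ x).1) : StrictlySmoothSetAt Ω x := by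
  have := nhdsWithin_neBot_of_mem hx
  have hf' : HasFDerivAtFilter f A (𝓝 (Φ x).1 ×ˢ 𝓝 (Φ x).1) :=
    nhds_prod_eq (x := (Φ x).1) (y := (Φ x).1) ▸ hf
  exact (c.quotientsTendsto hx hxs hf' le_rfl le_rfl
    ((Φ.continuousAt hxs).fst.mono_left nhdsWithin_le_nhds)).strictlySmoothSetAt

theorem setTendsto_quotientSet (c : IsLipschitzChart Ω Φ U f K) (hx : x ∈ Ω) (hxs : x ∈ Φ.source)
    (hf : DifferentiableAt ℝ f (Φ x).1) :
    SetTendsto (𝓝[>] (0 : ℝ)) (quotientSet Ω x)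
      (chartTangentSpace (fderiv ℝ Φ x) (fderiv ℝ f (Φ x).1)) :=
  (c.quotientsTendsto hx hxs hf.hasFDerivAt (pure_le_nhds _) (pure_le_nhdsWithin hx)
    (tendsto_pure_pure _ x)).setTendsto

theorem smoothSetAt (c : IsLipschitzChart Ω Φ U f K) (hx : x ∈ Ω) (hxs : x ∈ Φ.source)
    (hf : DifferentiableAt ℝ f (Φ x).1) : SmoothSetAt Ω x :=
  have h := c.setTendsto_quotientSet hx hxs hf
  ⟨h.1.trans h.2.symm, _, h.2⟩

theorem tendsto_prodMk_apply (c : IsLipschitzChart Ω Φ U f K) (hx : x ∈ Ω) (hxs : x ∈ Φ.source) :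
    Tendsto (fun u => (u, f u)) (𝓝 (Φ x).1) (𝓝 (Φ x)) := by
  obtain ⟨hU, hfx⟩ := mem_graphOn.1 (c.apply_mem_graphOn hx hxs)
  have hcont := c.lipschitzOnWith.continuousOn.continuousAt (c.isOpen.mem_nhds hU)
  have h := tendsto_id.prodMk_nhds hcont.tendsto
  rwa [hfx] at h

theorem tendsto_symm_prodMk (c : IsLipschitzChart Ω Φ U f K) (hx : x ∈ Ω) (hxs : x ∈ Φ.source) :
    Tendsto (fun u => Φ.symm (u, f u)) (𝓝[{u | DifferentiableAt ℝ f u}] (Φ x).1)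
      (𝓝[{y | y ∈ Ω ∧ SmoothSetAt Ω y}] x) := by
  refine tendsto_nhdsWithin_iff.2 ⟨((Φ.tendsto_symm hxs).comp
    (c.tendsto_prodMk_apply hx hxs)).mono_left nhdsWithin_le_nhds, ?_⟩
  filter_upwards [self_mem_nhdsWithin,
    nhdsWithin_le_nhds (c.isOpen.mem_nhds (c.fst_apply_mem hx hxs))] with u hu huU
  have hgraph : (u, f u) ∈ U.graphOn f := mem_graphOn.2 ⟨huU, rfl⟩
  have hΩ := c.symm_apply_mem hgraph
  refine ⟨hΩ, c.smoothSetAt hΩ (Φ.map_target (c.mem_target hgraph)) ?_⟩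
  rwa [Φ.right_inv (c.mem_target hgraph)]

theorem eventually_tangentCone_eq (c : IsLipschitzChart Ω Φ U f K) (hx : x ∈ Ω)
    (hxs : x ∈ Φ.source) : ∀ᶠ u in 𝓝[{u | DifferentiableAt ℝ f u}] (Φ x).1,
      tangentCone Ω (Φ.symm (u, f u)) =
        chartTangentSpace (fderiv ℝ Φ (Φ.symm (u, f u))) (fderiv ℝ f u) := by
  filter_upwards [self_mem_nhdsWithin,
    nhdsWithin_le_nhds (c.isOpen.mem_nhds (c.fst_apply_mem hx hxs))] with u hu huU
  have hgraph : (u, f u) ∈ U.graphOn f := mem_graphOn.2 ⟨huU, rfl⟩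
  have hinv := Φ.right_inv (c.mem_target hgraph)
  have h := (c.setTendsto_quotientSet (c.symm_apply_mem hgraph)
    (Φ.map_target (c.mem_target hgraph)) (by rwa [hinv])).2
  rwa [hinv] at h

theorem eq_chartTangentSpace_of_mem_limitingJacobian (c : IsLipschitzChart Ω Φ U f K) (hx : x ∈ Ω)
    (hxs : x ∈ Φ.source) {L : Set X}
    (hL : SetTendsto (𝓝[{y | y ∈ Ω ∧ SmoothSetAt Ω y}] x) (tangentCone Ω) L) {A : E →L[ℝ] F}
    (hA : A ∈ limitingJacobian f (Φ x).1) : L = chartTangentSpace (fderiv ℝ Φ x) A := by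
  set l := 𝓝[{u | DifferentiableAt ℝ f u}] (Φ x).1 ⊓ comap (fderiv ℝ f) (𝓝 A)
  have hl : l ≤ 𝓝[{u | DifferentiableAt ℝ f u}] (Φ x).1 := inf_le_left
  have : l.NeBot := by
    rw [← map_neBot_iff (fderiv ℝ f), Filter.push_pull, inf_comm]
    exact hA
  have hgraph := (c.tendsto_prodMk_apply hx hxs).mono_left (hl.trans nhdsWithin_le_nhds)
  have hpoint := (c.tendsto_symm_prodMk hx hxs).mono_left hl
  have hT := (c.continuousAt_fderiv hxs).tendsto.comp (tendsto_nhds_of_tendsto_nhdsWithin hpoint)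
  have hS := (c.continuousAt_fderiv_symm (Φ.map_source hxs)).tendsto.comp hgraph
  have hTS : ∀ᶠ u in l, (fderiv ℝ Φ (Φ.symm (u, f u))).comp (fderiv ℝ Φ.symm (u, f u)) =
      .id ℝ (E × F) :=
    (hgraph.eventually (Φ.open_target.mem_nhds (Φ.map_source hxs))).mono fun u hu =>
      c.fderiv_comp_fderiv_symm hu
  have hspaces := setTendsto_chartTangentSpace hT hS (tendsto_comap.mono_left inf_le_right) hTS
    (c.fderiv_symm_comp_fderiv hxs)
  exact ((hL.comp hpoint).congr (hl (c.eventually_tangentCone_eq hx hxs))).unique hspaces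

variable [FiniteDimensional ℝ E] [FiniteDimensional ℝ F]

theorem neBot_nhdsWithin_smoothSetAt (c : IsLipschitzChart Ω Φ U f K) (hx : x ∈ Ω)
    (hxs : x ∈ Φ.source) : (𝓝[{y | y ∈ Ω ∧ SmoothSetAt Ω y}] x).NeBot := by
  have := mem_closure_iff_nhdsWithin_neBot.1 (subset_closure_differentiableAt c.isOpen
    c.lipschitzOnWith (c.fst_apply_mem hx hxs))
  exact (c.tendsto_symm_prodMk hx hxs).neBot

theorem strictlySmoothSetAt_of_setTendsto (c : IsLipschitzChart Ω Φ U f K) (hx : x ∈ Ω)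
    (hxs : x ∈ Φ.source) {L : Set X}
    (hL : SetTendsto (𝓝[{y | y ∈ Ω ∧ SmoothSetAt Ω y}] x) (tangentCone Ω) L) :
    StrictlySmoothSetAt Ω x := by
  have hsurj : Function.Surjective (fderiv ℝ Φ x) := fun y => by
    have h := c.fderiv_comp_fderiv_symm (Φ.map_source hxs)
    rw [Φ.left_inv hxs] at h
    exact ⟨_, DFunLike.congr_fun h y⟩
  have hsub : (limitingJacobian f (Φ x).1).Subsingleton := fun A hA B hB =>
    chartTangentSpace_injective hsurj (SetLike.coe_injective
      ((c.eq_chartTangentSpace_of_mem_limitingJacobian hx hxs hL hA).symm.trans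
        (c.eq_chartTangentSpace_of_mem_limitingJacobian hx hxs hL hB)))
  obtain ⟨A, hA⟩ := exists_hasStrictFDerivAt_of_limitingJacobian_subsingleton c.isOpen
    c.lipschitzOnWith (c.fst_apply_mem hx hxs) hsub
  exact c.strictlySmoothSetAt hx hxs hA

end IsLipschitzChart

theorem LipschitzManifoldAround.exists_isLipschitzChart {Ω : Set X} {x : X}
    (h : LipschitzManifoldAround Ω x) :
    ∃ (Y Z : Submodule ℝ X) (Φ : OpenPartialHomeomorph X (Y × Z)) (U : Set Y) (f : Y → Z)
      (K : ℝ≥0), x ∈ Φ.source ∧ IsLipschitzChart Ω Φ U f K := by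
  obtain ⟨Y, Z, -, Φ, U, -, f, K, hx, hΦ, hΦsymm, hU, -, -, -, hf, himage⟩ := h
  refine ⟨Y, Z, Φ, U, f, K, hx, hΦ, hΦsymm, hU, hf, himage.trans ?_⟩
  ext p
  exact mem_graphOn.trans (and_congr_right' eq_comm) |>.symm

end Charts

end VarGeom

theorem theorem2p3_general {X : Type*} [NormedAddCommGroup X] [NormedSpace ℝ X]
    [FiniteDimensional ℝ X] {Ω : Set X} {xbar : X} (hx : xbar ∈ Ω) :
    (VarGeom.StrictlySmoothSetAt Ω xbar →
      VarGeom.SetTendsto (𝓝[Ω] xbar) (VarGeom.tangentCone Ω) (VarGeom.tangentCone Ω xbar)) ∧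
    (VarGeom.LipschitzManifoldAround Ω xbar →
      List.TFAE [
        VarGeom.StrictlySmoothSetAt Ω xbar,
        VarGeom.SetTendsto (𝓝[Ω] xbar) (VarGeom.tangentCone Ω) (VarGeom.tangentCone Ω xbar),
        VarGeom.SetTendsto (𝓝[{x | x ∈ Ω ∧ VarGeom.DerivableAt Ω x}] xbar)
          (VarGeom.tangentCone Ω) (VarGeom.tangentCone Ω xbar),
        VarGeom.SetTendsto (𝓝[{x | x ∈ Ω ∧ VarGeom.SmoothSetAt Ω x}] xbar)
          (VarGeom.tangentCone Ω) (VarGeom.tangentCone Ω xbar),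
        ∃ L : Set X, VarGeom.SetTendsto (𝓝[{x | x ∈ Ω ∧ VarGeom.SmoothSetAt Ω x}] xbar)
          (VarGeom.tangentCone Ω) L]) := by
  have := FiniteDimensional.proper_real X
  refine ⟨fun h => h.setTendsto_tangentCone hx, fun hΩ => ?_⟩
  obtain ⟨Y, Z, Φ, U, f, K, hxs, c⟩ := hΩ.exists_isLipschitzChart
  have hderivable : 𝓝[{x | x ∈ Ω ∧ VarGeom.DerivableAt Ω x}] xbar ≤ 𝓝[Ω] xbar :=
    nhdsWithin_mono _ fun x hx => hx.1
  have hsmooth : 𝓝[{x | x ∈ Ω ∧ VarGeom.SmoothSetAt Ω x}] xbar ≤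
      𝓝[{x | x ∈ Ω ∧ VarGeom.DerivableAt Ω x}] xbar :=
    nhdsWithin_mono _ fun x hx => ⟨hx.1, hx.2.1⟩
  have := c.neBot_nhdsWithin_smoothSetAt hx hxs
  have : (𝓝[{x | x ∈ Ω ∧ VarGeom.DerivableAt Ω x}] xbar).NeBot := .mono this hsmooth
  tfae_have 1 → 2 := fun h => h.setTendsto_tangentCone hx
  tfae_have 2 → 3 := fun h => h.mono hderivable
  tfae_have 3 → 4 := fun h => h.mono hsmooth
  tfae_have 4 → 5 := fun h => ⟨_, h⟩
  tfae_have 5 → 1 := fun ⟨_, hL⟩ => c.strictlySmoothSetAt_of_setTendsto hx hxs hL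
  tfae_finish

theorem theorem2p3 {X : Type*} [NormedAddCommGroup X] [InnerProductSpace ℝ X]
    [FiniteDimensional ℝ X] (Ω : Set X) (xbar : X) (hx : xbar ∈ Ω)
    (hΩ : VarGeom.LocallyClosedAround Ω xbar) :
    -- (a) implies (b)
    (VarGeom.StrictlySmoothSetAt Ω xbar →
      VarGeom.SetTendsto (𝓝[Ω] xbar) (VarGeom.tangentCone Ω) (VarGeom.tangentCone Ω xbar)) ∧
    -- on a Lipschitzian manifold (a) - (e) are equivalent
    (VarGeom.LipschitzManifoldAround Ω xbar →
      List.TFAE [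
        VarGeom.StrictlySmoothSetAt Ω xbar,
        VarGeom.SetTendsto (𝓝[Ω] xbar) (VarGeom.tangentCone Ω) (VarGeom.tangentCone Ω xbar),
        VarGeom.SetTendsto (𝓝[{x | x ∈ Ω ∧ VarGeom.DerivableAt Ω x}] xbar)
          (VarGeom.tangentCone Ω) (VarGeom.tangentCone Ω xbar),
        VarGeom.SetTendsto (𝓝[{x | x ∈ Ω ∧ VarGeom.SmoothSetAt Ω x}] xbar)
          (VarGeom.tangentCone Ω) (VarGeom.tangentCone Ω xbar),
        ∃ L : Set X, VarGeom.SetTendsto (𝓝[{x | x ∈ Ω ∧ VarGeom.SmoothSetAt Ω x}] xbar)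
          (VarGeom.tangentCone Ω) L]) :=
  theorem2p3_general hx
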